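/- Let $d\ge 1$, let $a_0,\dots,a_d$ be positive integers and $p(x)=a_0+a_1x+\dots+a_dx^d$. The Bratteli diagram of $p$ has vertices $(n,k)$, $n\ge 0$, $0\le k\le dn$, and exactly $a_j$ edges from $(n,k)$ to $(n+1,k+j)$ for $0\le j\le d$ (edges of slope $j$), and no other edges. Let $X_{p(x)}$ be the space of infinite edge paths $\gamma=\gamma_0\gamma_1\dots$ starting at $(0,0)$, with its Borel $\sigma$-algebra, and write $(n,k_n(\gamma))$ for the vertex of $\gamma$ at level $n$. Edges with the same range are ordered from left to right (by the second coordinate of their source, and parallel edges according to a fixed numbering that is the same at all vertices), and $\gamma<\xi$ if for some $n$ one has $\gamma_m=\xi_m$ for all $m>n$ and $\gamma_n<\xi_n$. The adic transformation $T_{p(x)}:X_{p(x)}\to X_{p(x)}$ maps each path that has a larger path to the next largest one. The remaining paths are the paths $\gamma^k_{\max}$, $k\in\{0,1,2,\dots\}\cup\{\infty\}$, through the vertices $(n,\min(k,dn))$ along the last of the parallel edges at each step. With $\gamma^k_{\min}$ the path through the vertices $(n,dn-\min(k,dn))$ along the first of the parallel edges at each step, $T_{p(x)}\gamma^k_{\max}=\gamma^k_{\min}$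 for $0<k<\infty$, $T_{p(x)}\gamma^0_{\max}=\gamma^\infty_{\min}$ and $T_{p(x)}\gamma^\infty_{\max}=\gamma^0_{\min}$. A measure on $X_{p(x)}$ is fully supported if every cylinder set $[\gamma_0\dots\gamma_{n-1}]$ has positive measure. For non-negative weights $p_0,\dots,p_d$ with $a_0p_0+\dots+a_dp_d=1$, the associated Bernoulli measure is the Borel probability measure for which the measure of each cylinder set $[\gamma_0\dots\gamma_{n-1}]$ is the product of the weights of its edges, an edge of slope $j$ having weight $p_j$. Theorem. For every $q\in(0,1/a_0)$ the equation $$a_0q^d+a_1q^{d-1}t+\dots+a_dt^d-q^{d-1}=0$$ has a unique solution $t=t_q$ in $[0,1]$. The fully supported $T_{p(x)}$-invariant ergodic Borel probability measures on $X_{p(x)}$ are exactly the Bernoulli measures $\mu_q$, $q\in(0,1/a_0)$, for which each edge of slope $j$ has weight $t_q^j/q^{j-1}$, $0\le j\le d$ (so $q$ for $j=0$ and $t_q$ for $j=1$). Different values of $q$ give different measures. -/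

import Mathlib

open MeasureTheory Set

namespace PolyAdic

variable {d : ℕ}

/-- An edge from level `n` to level `n + 1` of the Bratteli diagram of the polynomial
`p(x) = a 0 + a 1 x + ... + a d x ^ d` with positive integer coefficients. Level `n` has the
vertices `(n, k)`, `0 ≤ k ≤ d n`, and there are `a j` edges from `(n, k)` to `(n + 1, k + j)`
for `0 ≤ j ≤ d`; `idx` numbers these parallel edges from left to right. -/
@[ext]
structure Edge (a : Fin (d + 1) → ℕ+) (n : ℕ) where
  src : ℕ
  src_le : src ≤ d * n
  slope : Fin (d + 1)
  idx : Fin (a slope)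

/-- The alphabet labelling the `a 0 + ... + a d` edges that leave a vertex: a slope `j` together
with a number below `a j`. -/
abbrev Label (a : Fin (d + 1) → ℕ+) : Type := Σ j : Fin (d + 1), Fin (a j)

namespace Edge

variable {a : Fin (d + 1) → ℕ+} {n : ℕ}

/-- The second coordinate of the range vertex `(n + 1, k + j)`. -/
def tgt (e : Edge a n) : ℕ := e.src + e.slope

def label (e : Edge a n) : Label a := ⟨e.slope, e.idx⟩

/-- The ordering of edges with the same range: they increase from left to right, that is, first
by source vertex and then among parallel edges. -/
def lt (e f : Edge a n) : Prop :=
  e.tgt = f.tgt ∧ (e.src < f.src ∨ e.src = f.src ∧ (e.idx : ℕ) < (f.idx : ℕ))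

/-- The σ-algebra of all subsets of the finite set of edges at a given level. -/
instance : MeasurableSpace (Edge a n) := ⊤

end Edge

/-- The space `X` of infinite edge paths starting at the root `(0, 0)`. (The edge at level `0`
has source `(0, 0)` because `src ≤ d * 0`.) As a subspace of a countable product of finite
discrete spaces, `X` has as its Borel σ-algebra the one induced by the product σ-algebra; this is
the instance found by type class search. -/
abbrev PathSpace (a : Fin (d + 1) → ℕ+) : Type :=
  {γ : (n : ℕ) → Edge a n // ∀ n, (γ (n + 1)).src = (γ n).tgt}

variable {a : Fin (d + 1) → ℕ+}

/-- The cylinder set `[γ_0 γ_1 ... γ_{n-1}]`. -/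
def cylinder (γ : PathSpace a) (n : ℕ) : Set (PathSpace a) :=
  {ξ | ∀ i < n, ξ.1 i = γ.1 i}

/-- The partial order on paths: `γ < ξ` if the two paths agree after some level and the last
edges at which they disagree satisfy `γ_n < ξ_n`. -/
def pathLT (γ ξ : PathSpace a) : Prop :=
  ∃ n, (∀ m, n < m → γ.1 m = ξ.1 m) ∧ (γ.1 n).lt (ξ.1 n)

/-- `ξ` is the next largest path after `γ`. -/
def IsSuccessor (γ ξ : PathSpace a) : Prop :=
  pathLT γ ξ ∧ ∀ η, pathLT γ η → η = ξ ∨ pathLT ξ η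

theorem sum_slope_le (s : ℕ → Label a) (n : ℕ) :
    ∑ i ∈ Finset.range n, ((s i).1 : ℕ) ≤ d * n := by
  calc ∑ i ∈ Finset.range n, ((s i).1 : ℕ) ≤ ∑ _i ∈ Finset.range n, d :=
        Finset.sum_le_sum fun i _ => Nat.lt_succ_iff.mp (s i).1.2
    _ = d * n := by simp [mul_comm]

/-- The path whose edges carry the prescribed labels. -/
def ofLabels (s : ℕ → Label a) : PathSpace a :=
  ⟨fun n => ⟨∑ i ∈ Finset.range n, ((s i).1 : ℕ), sum_slope_le s n, (s n).1, (s n).2⟩,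
    fun _ => Finset.sum_range_succ _ _⟩

/-- `k_n = min (k, d n)` for `k ∈ {0, 1, ...} ∪ {∞}`. -/
def cornerVertex (d : ℕ) (k : ℕ∞) (n : ℕ) : ℕ :=
  if k = ⊤ then d * n else min k.toNat (d * n)

theorem cornerVertex_succ_le (d : ℕ) (k : ℕ∞) (n : ℕ) :
    cornerVertex d k (n + 1) ≤ cornerVertex d k n + d := by
  unfold cornerVertex
  split_ifs <;> simp only [mul_add, mul_one] <;> omega

/-- The slope of the `n`-th edge of a path through the vertices `(n, min (k, d n))`. -/
def cornerSlope (d : ℕ) (k : ℕ∞) (n : ℕ) : Fin (d + 1) :=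
  ⟨cornerVertex d k (n + 1) - cornerVertex d k n, by have := cornerVertex_succ_le d k n; omega⟩

/-- The maximal path `γ_max^k`: it passes through the vertices `(n, min (k, d n))`, so it
goes down the far right side, then to the vertex `k`, where it stays, along the last edge of each
bundle of parallel edges. -/
def maxPath (a : Fin (d + 1) → ℕ+) (k : ℕ∞) : PathSpace a :=
  ofLabels fun n => ⟨cornerSlope d k n, a (cornerSlope d k n) - 1,
    Nat.sub_lt (a (cornerSlope d k n)).pos one_pos⟩

/-- The minimal path `γ_min^k`: it passes through the vertices `(n, d n - min (k, d n))`,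
along the first edge of each bundle of parallel edges. -/
def minPath (a : Fin (d + 1) → ℕ+) (k : ℕ∞) : PathSpace a :=
  ofLabels fun n => ⟨(cornerSlope d k n).rev, 0, (a (cornerSlope d k n).rev).pos⟩

/-- `0 ↦ ∞`, `∞ ↦ 0`, and `k ↦ k` for `0 < k < ∞`. -/
def swapEnds (k : ℕ∞) : ℕ∞ := if k = 0 then ⊤ else if k = ⊤ then 0 else k

open Classical in
/-- The adic (Bratteli-Vershik) transformation `T_{p(x)}`: a path that has a successor is mapped
to it; the paths without successor are the maximal paths, and `γ_max^k ↦ γ_min^k` for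
`0 < k < ∞`, `γ_max^0 ↦ γ_min^∞`, `γ_max^∞ ↦ γ_min^0`. (The last branch never occurs.) -/
noncomputable def adic (a : Fin (d + 1) → ℕ+) (γ : PathSpace a) : PathSpace a :=
  if h : ∃ ξ, IsSuccessor γ ξ then h.choose
  else if h : ∃ k : ℕ∞, γ = maxPath a k then minPath a (swapEnds h.choose)
  else γ

/-- Every cylinder set has positive measure. -/
def FullySupported (μ : Measure (PathSpace a)) : Prop :=
  ∀ (γ : PathSpace a) (n : ℕ), 0 < μ (cylinder γ n)

/-- The measure on the alphabet with the given weights. -/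
noncomputable def labelMeasure (w : Label a → ℝ) : Measure (Label a) :=
  ∑ l, ENNReal.ofReal (w l) • Measure.dirac l

/-- The Bernoulli measure on the path space: the labels of the edges of a path are independent,
each with the distribution given by the weights `w`. -/
noncomputable def bernoulli (w : Label a → ℝ) : Measure (PathSpace a) :=
  (Measure.infinitePi fun _ : ℕ => labelMeasure w).map ofLabels

/-- The left-hand side of
`a_0 q^d + a_1 q^(d-1) t + ... + a_d t^d - q^(d-1) = 0`. -/
noncomputable def charPoly (a : Fin (d + 1) → ℕ+) (q t : ℝ) : ℝ :=
  ∑ j : Fin (d + 1), ((a j : ℕ) : ℝ) * q ^ (d - (j : ℕ)) * t ^ (j : ℕ) - q ^ (d - 1)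

/-- Each edge of slope `j` gets the weight `t^j / q^(j-1)`; for `j = 0` this is `q`. -/
noncomputable def slopeWeight (a : Fin (d + 1) → ℕ+) (q t : ℝ) : Label a → ℝ :=
  fun l => t ^ (l.1 : ℕ) / q ^ (((l.1 : ℕ) : ℤ) - 1)

end PolyAdic

/-! A path is the same as its sequence of labels. The successor map replaces a finite prefix by
another with the same end vertex, whatever the tail, and only countably many paths have no
successor. So a finite measure without atoms is invariant exactly when the mass of a cylinder
depends only on its end vertex (`central_of_measurePreserving`, `Central.measurePreserving`).

The end vertex is a sum of slopes, so it ignores the order of the labels, and central measures are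
also shift-invariant. If such a measure is ergodic, conditioning on the first label and shifting
gives a central measure dominated by the original one, hence a multiple of it. This makes the
measure a product (`Central.measure_seqCylinder_cons`). Centrality on paths of length 1 and 2 then
forces the weights into a geometric progression in the slope, and their normalisation is the stated
equation.

Conversely, such weights give mass `q ^ n * (t / q) ^ k` to a cylinder ending at `(n, k)`, so the
product measure is central. Its restriction to an invariant set is invariant, hence central, hence
shift-invariant. Ergodicity of the shift makes it a multiple of the whole measure, so the set is
trivial (`ergodic_infinitePi_of_central`). -/

namespace PolyAdic

variable {d : ℕ} {a : Fin (d + 1) → ℕ+}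

/-! ### The order on label sequences and its successors -/

/-- The second coordinate of the vertex at level `n` of the path with labels `s`. -/
def partialSum (s : ℕ → Label a) (n : ℕ) : ℕ := ∑ i ∈ Finset.range n, ((s i).1 : ℕ)

theorem partialSum_succ (s : ℕ → Label a) (n : ℕ) :
    partialSum s (n + 1) = partialSum s n + (s n).1 := Finset.sum_range_succ _ _

theorem partialSum_congr {u v : ℕ → Label a} {n : ℕ} (h : ∀ i < n, u i = v i) :
    partialSum u n = partialSum v n :=
  Finset.sum_congr rfl fun i hi => by rw [h i (Finset.mem_range.mp hi)]

/-- The order of the labels of edges with a common range: a larger slope means a source further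
to the left. -/
def labelLT (l m : Label a) : Prop :=
  (m.1 : ℕ) < l.1 ∨ (l.1 : ℕ) = m.1 ∧ (l.2 : ℕ) < m.2

theorem labelLT_irrefl (l : Label a) : ¬ labelLT l l := by
  unfold labelLT; omega

theorem labelLT_trans {l m r : Label a} (h : labelLT l m) (h' : labelLT m r) : labelLT l r := by
  unfold labelLT at *; omega

theorem label_ext {l m : Label a} (h : (l.1 : ℕ) = m.1) (h' : (l.2 : ℕ) = m.2) : l = m := by
  obtain ⟨j, i⟩ := l
  obtain ⟨j', i'⟩ := m
  obtain rfl : j = j' := Fin.ext h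
  obtain rfl : i = i' := Fin.ext h'
  rfl

theorem labelLT_or_labelLT_of_ne {l m : Label a} (h : l ≠ m) : labelLT l m ∨ labelLT m l := by
  by_contra! h'
  unfold labelLT at h'
  exact h (label_ext (by omega) (by omega))

/-- The paths with labels `u` and `v` have the same edges from level `n` on. -/
def SameTail (n : ℕ) (u v : ℕ → Label a) : Prop :=
  (∀ i, n ≤ i → u i = v i) ∧ partialSum u n = partialSum v n

theorem SameTail.refl (n : ℕ) (u : ℕ → Label a) : SameTail n u u := ⟨fun _ _ => rfl, rfl⟩

theorem SameTail.symm {n : ℕ} {u v : ℕ → Label a} (h : SameTail n u v) : SameTail n v u :=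
  ⟨fun i hi => (h.1 i hi).symm, h.2.symm⟩

theorem SameTail.trans {n : ℕ} {u v w : ℕ → Label a} (h : SameTail n u v)
    (h' : SameTail n v w) : SameTail n u w :=
  ⟨fun i hi => (h.1 i hi).trans (h'.1 i hi), h.2.trans h'.2⟩

theorem SameTail.mono {n m : ℕ} {u v : ℕ → Label a} (h : SameTail n u v) (hnm : n ≤ m) :
    SameTail m u v := by
  induction m, hnm using Nat.le_induction with
  | base => exact h
  | succ m hm ih =>
    exact ⟨fun i hi => h.1 i (by omega), by
      rw [partialSum_succ, partialSum_succ, ih.2, h.1 m hm]⟩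

theorem finite_sameTail (n : ℕ) (v : ℕ → Label a) : {u | SameTail n u v}.Finite := by
  refine Set.Finite.of_finite_image (f := fun u (i : Fin n) => u i) (Set.toFinite _) ?_
  intro u hu u' hu' h
  funext i
  by_cases hi : i < n
  · exact congrFun h ⟨i, hi⟩
  · rw [hu.1 i (by omega), hu'.1 i (by omega)]

/-- The order of paths in terms of their labels. -/
def seqLT (u v : ℕ → Label a) : Prop :=
  ∃ n, SameTail (n + 1) u v ∧ labelLT (u n) (v n)

instance : IsStrictOrder (ℕ → Label a) seqLT where
  irrefl u := fun ⟨_, _, h⟩ => labelLT_irrefl _ h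
  trans u v w := by
    rintro ⟨k, h, hk⟩ ⟨l, h', hl⟩
    rcases lt_trichotomy k l with hkl | rfl | hkl
    · exact ⟨l, (h.mono (by omega)).trans h', by rwa [h.1 l (by omega)]⟩
    · exact ⟨k, h.trans h', labelLT_trans hk hl⟩
    · exact ⟨k, h.trans (h'.mono (by omega)), by rwa [← h'.1 k (by omega)]⟩

theorem seqLT_asymm {u v : ℕ → Label a} (h : seqLT u v) (h' : seqLT v u) : False :=
  irrefl_of seqLT u (trans_of seqLT h h')

/-- The last disagreement decides: if the labels at `n` agree, so do the vertices at level `n`, and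
the common tail starts one level earlier. -/
theorem SameTail.eq_or_seqLT {n : ℕ} {u v : ℕ → Label a} (h : SameTail n u v) :
    u = v ∨ seqLT u v ∨ seqLT v u := by
  induction n with
  | zero => exact .inl (funext fun i => h.1 i (by omega))
  | succ n ih =>
    by_cases hn : u n = v n
    · refine ih ⟨fun i hi => ?_, ?_⟩
      · rcases eq_or_lt_of_le hi with rfl | hi
        · exact hn
        · exact h.1 i hi
      · have := h.2
        rw [partialSum_succ, partialSum_succ, hn] at this
        omega
    · rcases labelLT_or_labelLT_of_ne hn with h' | h'
      · exact .inr (.inl ⟨n, h, h'⟩)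
      · exact .inr (.inr ⟨n, h.symm, h'⟩)

/-- Confines the search for successors and predecessors to one finite tail class: anything larger
outside the class of `u` lies above the whole class. -/
theorem seqLT.sameTail_or {u w : ℕ → Label a} (h : seqLT u w) (n : ℕ) :
    SameTail n u w ∨ ∀ v, SameTail n u v → seqLT v w := by
  obtain ⟨m, hm, h⟩ := h
  rcases lt_or_ge m n with hmn | hmn
  · exact .inl (hm.mono hmn)
  · exact .inr fun v hv => ⟨m, (hv.symm.mono (by omega)).trans hm, by rwa [← hv.1 m hmn]⟩

/-- `v` is the next largest label sequence after `u`. -/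
def SeqSucc (u v : ℕ → Label a) : Prop :=
  seqLT u v ∧ ∀ w, seqLT u w → w = v ∨ seqLT v w

theorem SeqSucc.right_unique {u v v' : ℕ → Label a} (h : SeqSucc u v) (h' : SeqSucc u v') :
    v = v' := by
  rcases h.2 v' h'.1 with e | l
  · exact e.symm
  rcases h'.2 v h.1 with e | l'
  · exact e
  exact (seqLT_asymm l l').elim

/-- Both predecessors share a tail with `v`, so they are comparable, and the larger one would lie
strictly between the smaller one and `v`. -/
theorem SeqSucc.left_unique {u u' v : ℕ → Label a} (h : SeqSucc u v) (h' : SeqSucc u' v) :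
    u = u' := by
  obtain ⟨k, hk, hk'⟩ := h.1
  obtain ⟨l, hl, hl'⟩ := h'.1
  rcases ((hk.mono (Nat.le_add_right _ l)).trans
    (hl.mono (by omega)).symm : SameTail (k + 1 + l) u u').eq_or_seqLT with e | lt | lt
  · exact e
  · rcases h.2 u' lt with rfl | lt'
    · exact (irrefl_of seqLT _ h'.1).elim
    · exact (seqLT_asymm h'.1 lt').elim
  · rcases h'.2 u lt with rfl | lt'
    · exact (irrefl_of seqLT _ h.1).elim
    · exact (seqLT_asymm h.1 lt').elim

theorem exists_seqSucc {u v : ℕ → Label a} (h : seqLT u v) : ∃ w, SeqSucc u w := by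
  obtain ⟨k, hk, hk'⟩ := id h
  have hfin : {w | SameTail (k + 1) w u ∧ seqLT u w}.Finite :=
    (finite_sameTail (k + 1) u).subset fun w hw => hw.1
  obtain ⟨⟨w, hw, hw'⟩, -, hmin⟩ := WellFounded.has_min (hfin.wellFoundedOn (r := seqLT))
    Set.univ ⟨⟨v, hk.symm, h⟩, trivial⟩
  refine ⟨w, hw', fun x hx => ?_⟩
  rcases hx.sameTail_or (k + 1) with hx' | hx'
  · rcases (hx'.symm.trans hw.symm).eq_or_seqLT with e | lt | lt
    · exact .inl e
    · exact (hmin ⟨x, hx'.symm, hx⟩ trivial lt).elim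
    · exact .inr lt
  · exact .inr (hx' w hw.symm)

/-- The predecessor is the maximum of a finite set. It stays in the tail class at the given level
`n`, which permits descent inside a class. -/
theorem exists_seqSucc_left {n : ℕ} {u v : ℕ → Label a} (h : seqLT u v) (ht : SameTail n u v) :
    ∃ w, SameTail n w v ∧ SeqSucc w v := by
  have hfin : {w | SameTail n w v ∧ seqLT w v}.Finite :=
    (finite_sameTail n v).subset fun w hw => hw.1
  obtain ⟨⟨w, hw, hw'⟩, -, hmax⟩ := WellFounded.has_min
    (hfin.wellFoundedOn (r := Function.swap seqLT)) Set.univ ⟨⟨u, ht, h⟩, trivial⟩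
  refine ⟨w, hw, hw', fun x hx => ?_⟩
  rcases hx.sameTail_or n with hx' | hx'
  · rcases (hx'.symm.trans hw).eq_or_seqLT with e | lt | lt
    · exact .inl e
    · exact (hmax ⟨x, hx'.symm.trans hw, lt⟩ trivial hx).elim
    · exact .inr lt
  · exact .inr (hx' v hw)

/-- The sequence that starts with the first `n` terms of `u` and continues as `s`. -/
def splice (n : ℕ) (u s : ℕ → Label a) : ℕ → Label a := fun i => if i < n then u i else s i

theorem splice_of_lt {n i : ℕ} (u s : ℕ → Label a) (h : i < n) : splice n u s i = u i := if_pos h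

theorem splice_of_le {n i : ℕ} (u s : ℕ → Label a) (h : n ≤ i) : splice n u s i = s i :=
  if_neg (by omega)

theorem splice_eq_self {n : ℕ} {u s : ℕ → Label a} (h : ∀ i < n, s i = u i) :
    splice n u s = s := by
  funext i
  by_cases hi : i < n
  · rw [splice_of_lt _ _ hi, h i hi]
  · rw [splice_of_le _ _ (by omega)]

theorem partialSum_splice {n m : ℕ} (u s : ℕ → Label a) (h : m ≤ n) :
    partialSum (splice n u s) m = partialSum u m :=
  partialSum_congr fun i hi => splice_of_lt _ _ (by omega)

theorem sameTail_splice {n : ℕ} {u v : ℕ → Label a} (s : ℕ → Label a)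
    (h : partialSum u n = partialSum v n) : SameTail n (splice n u s) (splice n v s) :=
  ⟨fun i hi => by rw [splice_of_le _ _ hi, splice_of_le _ _ hi], by
    rwa [partialSum_splice _ _ le_rfl, partialSum_splice _ _ le_rfl]⟩

theorem seqLT.splice {n : ℕ} {u v : ℕ → Label a} (h : seqLT u v) (ht : SameTail n u v)
    (s : ℕ → Label a) : seqLT (splice n u s) (splice n v s) := by
  obtain ⟨k, hk, hk'⟩ := h
  have hkn : k < n := by
    by_contra! hn
    rw [ht.1 k hn] at hk'
    exact labelLT_irrefl _ hk'
  refine ⟨k, ⟨fun i hi => ?_, ?_⟩, ?_⟩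
  · unfold PolyAdic.splice
    rw [hk.1 i hi]
  · rw [partialSum_splice _ _ hkn, partialSum_splice _ _ hkn, hk.2]
  · rwa [splice_of_lt _ _ hkn, splice_of_lt _ _ hkn]

/-- Being the successor does not depend on the common tail. -/
theorem SeqSucc.splice {n : ℕ} {u v : ℕ → Label a} (h : SeqSucc u v) (ht : SameTail n u v)
    (s : ℕ → Label a) : SeqSucc (splice n u s) (splice n v s) := by
  refine ⟨h.1.splice ht s, fun w hw => ?_⟩
  -- A competitor with tail `s` is moved back to the tail of `u`, where `h` decides; any other lies
  -- above the whole tail class.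
  rcases hw.sameTail_or n with hw' | hw'
  · have hwu : partialSum w n = partialSum u n := by
      rw [← hw'.2, partialSum_splice _ _ le_rfl]
    have e : PolyAdic.splice n (PolyAdic.splice n w u) s = w := by
      funext i
      by_cases hi : i < n
      · rw [splice_of_lt _ _ hi, splice_of_lt _ _ hi]
      · rw [splice_of_le _ _ (by omega), ← hw'.1 i (by omega), splice_of_le _ _ (by omega)]
    have e' : PolyAdic.splice n (PolyAdic.splice n u s) u = u := splice_eq_self fun i hi => by
      rw [splice_of_lt _ _ hi]
    have hlt := hw.splice hw' u
    rw [e'] at hlt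
    have ht' : SameTail n v (PolyAdic.splice n w u) := by
      refine ht.symm.trans ?_
      have := sameTail_splice (u := PolyAdic.splice n u s) (v := w) u
        (by rw [partialSum_splice _ _ le_rfl, hwu])
      rwa [e'] at this
    rcases h.2 _ hlt with e'' | lt
    · exact .inl (by rw [← e'', e])
    · right
      simpa only [e] using lt.splice ht' s
  · exact .inr (hw' _ (sameTail_splice s ht.2))

/-- The label sequences without successor are eventually constant. -/
theorem countable_not_seqSucc (hd : 1 ≤ d) (a : Fin (d + 1) → ℕ+) :
    {u : ℕ → Label a | ¬ ∃ v, SeqSucc u v}.Countable := by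
  have hcount : ∀ c : Label a, {u : ℕ → Label a | ∃ n, ∀ i, n ≤ i → u i = c}.Countable := by
    intro c
    rw [Set.ofPred_exists]
    refine Set.countable_iUnion fun n => Set.Finite.countable ?_
    refine Set.Finite.of_finite_image (f := fun u (i : Fin n) => u i) (Set.toFinite _) ?_
    intro u hu u' hu' h
    funext i
    by_cases hi : i < n
    · exact congrFun h ⟨i, hi⟩
    · rw [hu i (by omega), hu' i (by omega)]
  have hlast : ∀ j : Fin (d + 1), (a j : ℕ) - 1 < a j := fun j =>
    Nat.sub_lt (a j).pos one_pos
  refine (Set.countable_iUnion fun c : Label a => hcount c).mono fun u hu => ?_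
  have hmax : ∀ v, ¬ seqLT u v := fun v hv => hu (exists_seqSucc hv)
  -- Otherwise taking the next parallel edge at place `i` would give a larger path.
  have hidx : ∀ i, ((u i).2 : ℕ) = a (u i).1 - 1 := by
    intro i
    by_contra hne
    have hlt : ((u i).2 : ℕ) + 1 < a (u i).1 := by have := (u i).2.2; omega
    let l : Label a := ⟨(u i).1, ⟨(u i).2 + 1, hlt⟩⟩
    refine hmax (Function.update u i l) ⟨i, ⟨fun k hk => ?_, ?_⟩, ?_⟩
    · rw [Function.update_of_ne (by omega)]
    · rw [partialSum_succ, partialSum_succ, Function.update_self]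
      congr 1
      exact partialSum_congr fun k hk => by rw [Function.update_of_ne (by omega)]
    · rw [Function.update_self]
      right
      simp [l]
  -- Otherwise moving one unit of slope from place `i + 1` to place `i` keeps the vertex at level `i
  -- + 2` and gives a larger path. Hence the slopes read `d, …, d, j, 0, 0, …`.
  have hslope : ∀ i, ((u i).1 : ℕ) = d ∨ ((u (i + 1)).1 : ℕ) = 0 := by
    intro i
    by_contra! hne
    have h1 : ((u i).1 : ℕ) + 1 < d + 1 := by have := (u i).1.2; omega
    have h2 : ((u (i + 1)).1 : ℕ) - 1 < d + 1 := by have := (u (i + 1)).1.2; omega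
    let l : Label a := ⟨⟨(u i).1 + 1, h1⟩, ⟨0, (a _).pos⟩⟩
    let r : Label a := ⟨⟨(u (i + 1)).1 - 1, h2⟩, ⟨0, (a _).pos⟩⟩
    refine hmax (Function.update (Function.update u i l) (i + 1) r)
      ⟨i + 1, ⟨fun k hk => ?_, ?_⟩, ?_⟩
    · rw [Function.update_of_ne (by omega), Function.update_of_ne (by omega)]
    · rw [partialSum_succ, partialSum_succ, partialSum_succ, partialSum_succ,
        Function.update_self, Function.update_of_ne (by omega), Function.update_self]
      rw [partialSum_congr (u := Function.update _ _ _) (v := u) fun k hk => by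
        rw [Function.update_of_ne (by omega), Function.update_of_ne (by omega)]]
      simp only [l, r]
      omega
    · rw [Function.update_self]
      left
      simp only [r]
      omega
  have hext : ∀ i j : ℕ, ((u i).1 : ℕ) = (u j).1 → u i = u j := by
    intro i j h
    have h' : (u i).1 = (u j).1 := Fin.ext h
    exact label_ext h (by rw [hidx, hidx, h'])
  rw [Set.mem_iUnion]
  by_cases hall : ∀ i, ((u i).1 : ℕ) = d
  · exact ⟨u 0, 0, fun i _ => hext _ _ (by rw [hall, hall])⟩
  · push Not at hall
    obtain ⟨i, hi⟩ := hall
    have hz : ∀ k, i + 1 ≤ k → ((u k).1 : ℕ) = 0 := by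
      intro k hk
      induction k, hk using Nat.le_induction with
      | base => exact (hslope i).resolve_left hi
      | succ k hk ih => exact (hslope k).resolve_left (by omega)
    exact ⟨u (i + 1), i + 1, fun k hk => hext _ _ (by rw [hz k hk, hz _ le_rfl])⟩

/-! ### Cylinder sets as a generating π-system -/

instance : DiscreteMeasurableSpace (Label a) where
  forall_measurableSet s :=
    MeasurableSpace.measurableSet_iInf.mpr fun j => MeasurableSet.of_discrete (s := Sigma.mk j ⁻¹' s)

instance : Inhabited (Label a) := ⟨⟨0, ⟨0, (a 0).pos⟩⟩⟩

/-- The cylinder set of the label sequences that agree with `s` below `n`. -/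
def seqCylinder (s : ℕ → Label a) (n : ℕ) : Set (ℕ → Label a) := {u | ∀ i < n, u i = s i}

theorem mem_seqCylinder_self (s : ℕ → Label a) (n : ℕ) : s ∈ seqCylinder s n := fun _ _ => rfl

theorem seqCylinder_zero (s : ℕ → Label a) : seqCylinder s 0 = univ :=
  eq_univ_of_forall fun _ i hi => absurd hi (Nat.not_lt_zero i)

theorem seqCylinder_congr {s u : ℕ → Label a} {n : ℕ} (h : ∀ i < n, s i = u i) :
    seqCylinder s n = seqCylinder u n := by
  ext w
  exact forall₂_congr fun i hi => by rw [h i hi]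

theorem seqCylinder_anti (s : ℕ → Label a) {n m : ℕ} (h : n ≤ m) :
    seqCylinder s m ⊆ seqCylinder s n := fun _ hu i hi => hu i (by omega)

theorem measurableSet_eval_eq (i : ℕ) (l : Label a) :
    MeasurableSet {u : ℕ → Label a | u i = l} :=
  (MeasurableSet.singleton l).preimage (measurable_pi_apply i)

theorem measurableSet_seqCylinder (s : ℕ → Label a) (n : ℕ) :
    MeasurableSet (seqCylinder s n) := by
  have : seqCylinder s n = ⋂ i, ⋂ (_ : i < n), {u | u i = s i} := by
    ext u; simp [seqCylinder]
  rw [this]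
  exact .iInter fun i => .iInter fun _ => measurableSet_eval_eq i (s i)

theorem countable_seqCylinders :
    {c : Set (ℕ → Label a) | ∃ s n, c = seqCylinder s n}.Countable := by
  refine (countable_range fun w : Σ n, Fin n → Label a =>
    {u : ℕ → Label a | ∀ i : Fin w.1, u i = w.2 i}).mono ?_
  rintro _ ⟨s, n, rfl⟩
  exact ⟨⟨n, fun i => s i⟩, by ext u; simp [seqCylinder, Fin.forall_iff]⟩

theorem seqCylinder_inter (s u : ℕ → Label a) {n m : ℕ} (h : n ≤ m) :
    seqCylinder s n ∩ seqCylinder u m = ∅ ∨ seqCylinder s n ∩ seqCylinder u m = seqCylinder u m := by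
  by_cases hs : ∀ i < n, u i = s i
  · right
    rw [← seqCylinder_congr hs]
    exact inter_eq_right.mpr (seqCylinder_anti u h)
  · left
    push Not at hs
    obtain ⟨i, hi, hne⟩ := hs
    ext w
    simp only [mem_inter_iff, mem_empty_iff_false, iff_false, not_and]
    intro h1 h2
    exact hne ((h2 i (by omega)).symm.trans (h1 i hi))

/-- A coordinate event is the union of the cylinders inside it, and there are only countably many
cylinders. The empty set is included as the intersection of disjoint cylinders. -/
theorem generateFrom_seqCylinders :
    (MeasurableSpace.pi : MeasurableSpace (ℕ → Label a)) = MeasurableSpace.generateFrom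
      (insert ∅ {c : Set (ℕ → Label a) | ∃ s n, c = seqCylinder s n}) := by
  refine le_antisymm ?_ (MeasurableSpace.generateFrom_le ?_)
  · refine iSup_le fun i => Measurable.comap_le ?_
    refine @measurable_to_countable' _ _ _ _ (MeasurableSpace.generateFrom _) _ fun l => ?_
    have : (fun u : ℕ → Label a => u i) ⁻¹' {l} =
        ⋃₀ {c | (∃ s n, c = seqCylinder s n) ∧ c ⊆ {u | u i = l}} := by
      ext u
      constructor
      · intro hu
        refine ⟨seqCylinder u (i + 1), ⟨⟨u, i + 1, rfl⟩, fun w hw => ?_⟩, mem_seqCylinder_self _ _⟩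
        exact (hw i (by omega)).trans hu
      · rintro ⟨c, ⟨-, hc⟩, hu⟩
        exact hc hu
    rw [this]
    refine MeasurableSet.sUnion (countable_seqCylinders.mono fun c hc => hc.1) fun c hc => ?_
    exact MeasurableSpace.measurableSet_generateFrom (.inr hc.1)
  · rintro _ (rfl | ⟨s, n, rfl⟩)
    · exact MeasurableSet.empty
    · exact measurableSet_seqCylinder s n

theorem measure_ext_of_seqCylinder {μ ν : Measure (ℕ → Label a)} [IsFiniteMeasure μ]
    (h : ∀ s n, μ (seqCylinder s n) = ν (seqCylinder s n)) : μ = ν := by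
  refine ext_of_generate_finite _ generateFrom_seqCylinders ?_ ?_ ?_
  · rintro _ (rfl | ⟨s, n, rfl⟩) _ (rfl | ⟨u, m, rfl⟩) -
    · simp
    · simp
    · simp
    · rcases le_total n m with hnm | hnm
      · rcases seqCylinder_inter s u hnm with h | h
        · exact .inl h
        · exact .inr ⟨u, m, h⟩
      · rw [inter_comm]
        rcases seqCylinder_inter u s hnm with h | h
        · exact .inl h
        · exact .inr ⟨s, n, h⟩
  · rintro _ (rfl | ⟨s, n, rfl⟩)
    · simp
    · exact h s n
  · simpa only [seqCylinder_zero] using h default 0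

/-! ### Invariance under the adic map and centrality -/

/-- The measure of a cylinder set depends only on the vertex where the cylinder ends. -/
def Central (μ : Measure (ℕ → Label a)) : Prop :=
  ∀ ⦃n : ℕ⦄ ⦃u v : ℕ → Label a⦄, partialSum u n = partialSum v n →
    μ (seqCylinder u n) = μ (seqCylinder v n)

section adic

variable {T : (ℕ → Label a) → ℕ → Label a}

/-- Passing from `u` to `v` changes only a prefix, so it works for every tail; the two directions
are the uniqueness of predecessors and of successors. -/
theorem mem_seqCylinder_iff_of_seqSucc (hT : ∀ u v, SeqSucc u v → T u = v) {n : ℕ}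
    {u v w : ℕ → Label a} (h : SeqSucc u v) (ht : SameTail n u v) (hw : ∃ z, SeqSucc w z) :
    T w ∈ seqCylinder v n ↔ w ∈ seqCylinder u n := by
  obtain ⟨z, hz⟩ := hw
  rw [hT w z hz]
  constructor
  · intro hzv
    have h' := h.splice ht z
    rw [splice_eq_self hzv] at h'
    rw [hz.left_unique h']
    exact fun i hi => splice_of_lt _ _ hi
  · intro hwu
    have h' := h.splice ht w
    rw [splice_eq_self hwu] at h'
    rw [hz.right_unique h']
    exact fun i hi => splice_of_lt _ _ hi

theorem measurable_splice (n : ℕ) (v : ℕ → Label a) : Measurable (splice n v) := by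
  refine measurable_pi_lambda _ fun i => ?_
  by_cases hi : i < n
  · simpa only [splice_of_lt _ _ hi] using measurable_const
  · simpa only [splice_of_le _ _ (not_lt.mp hi)] using measurable_pi_apply i

/-- Near a path with a successor `T` is a prefix exchange. Countably many such pieces and a
countable exceptional set exhaust the space, so the values of `T` on that set do not matter. -/
theorem measurable_of_seqSucc (hd : 1 ≤ d) (hT : ∀ u v, SeqSucc u v → T u = v) :
    Measurable T := by
  intro B hB
  have hM := countable_not_seqSucc hd a
  set M := {u : ℕ → Label a | ¬ ∃ v, SeqSucc u v}
  have : T ⁻¹' B = (T ⁻¹' B ∩ M) ∪ ⋃₀ {c | c ⊆ T ⁻¹' B ∧ ∃ n u v, SeqSucc u v ∧ SameTail n u v ∧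
      c = seqCylinder u n ∩ splice n v ⁻¹' B} := by
    ext u
    constructor
    · intro hu
      by_cases hs : ∃ v, SeqSucc u v
      · right
        obtain ⟨v, hv⟩ := hs
        obtain ⟨k, hk, -⟩ := hv.1
        have hTw : ∀ w ∈ seqCylinder u (k + 1), T w = splice (k + 1) v w := by
          intro w hw
          refine hT _ _ ?_
          have h' := hv.splice hk w
          rwa [splice_eq_self hw] at h'
        refine ⟨_, ⟨fun w hw => ?_, k + 1, u, v, hv, hk, rfl⟩, mem_seqCylinder_self _ _, ?_⟩
        · rw [mem_preimage, hTw w hw.1]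
          exact hw.2
        · rw [mem_preimage, ← hTw u (mem_seqCylinder_self _ _)]
          exact hu
      · exact .inl ⟨hu, hs⟩
    · rintro (hu | ⟨c, ⟨hc, -⟩, hu⟩)
      · exact hu.1
      · exact hc hu
  rw [this]
  refine (hM.mono inter_subset_right).measurableSet.union (MeasurableSet.sUnion ?_ ?_)
  · refine (countable_range fun p : (Σ n, Fin n → Label a) × (Σ n, Fin n → Label a) =>
      {u : ℕ → Label a | ∀ i : Fin p.1.1, u i = p.1.2 i} ∩
        (fun u i => if h : i < p.2.1 then p.2.2 ⟨i, h⟩ else u i) ⁻¹' B).mono ?_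
    rintro _ ⟨-, n, u, v, -, -, rfl⟩
    refine ⟨⟨⟨n, fun i => u i⟩, ⟨n, fun i => v i⟩⟩, ?_⟩
    simp only [Fin.forall_iff, dite_eq_ite]
    rfl
  · rintro _ ⟨-, n, u, v, -, -, rfl⟩
    exact (measurableSet_seqCylinder u n).inter (measurable_splice n v hB)

/-- Cylinders ending at one vertex are linked by successor steps, each of which preserves the
measure. Descent by predecessors brings all of them to the least element of the finite tail class.
-/
theorem central_of_measurePreserving (hd : 1 ≤ d) (hT : ∀ u v, SeqSucc u v → T u = v)
    {μ : Measure (ℕ → Label a)} [NullSingletonClass μ] (hμ : MeasurePreserving T μ μ) :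
    Central μ := by
  have hM : μ {u : ℕ → Label a | ¬ ∃ v, SeqSucc u v} = 0 :=
    (countable_not_seqSucc hd a).measure_zero μ
  have hsucc : ∀ ⦃n : ℕ⦄ ⦃u v : ℕ → Label a⦄, SeqSucc u v → SameTail n u v →
      μ (seqCylinder u n) = μ (seqCylinder v n) := by
    intro n u v h ht
    rw [← hμ.measure_preimage (measurableSet_seqCylinder v n).nullMeasurableSet]
    refine measure_congr ?_
    filter_upwards [compl_mem_ae_iff.mpr hM] with w hw
    exact propext (mem_seqCylinder_iff_of_seqSucc hT h ht (not_not.mp hw)).symm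
  intro n u v h
  have hfin := finite_sameTail n u
  obtain ⟨⟨u₀, hu₀⟩, -, hmin⟩ := WellFounded.has_min (hfin.wellFoundedOn (r := seqLT))
    Set.univ ⟨⟨u, SameTail.refl n u⟩, trivial⟩
  have key : ∀ w, SameTail n w u → μ (seqCylinder w n) = μ (seqCylinder u₀ n) := by
    intro w hw
    refine (hfin.wellFoundedOn (r := seqLT)).induction
      (P := fun w => μ (seqCylinder w n) = μ (seqCylinder u₀ n)) hw fun y hy ih => ?_
    rcases (hy.trans hu₀.symm).eq_or_seqLT with rfl | lt | lt
    · rfl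
    · exact (hmin ⟨y, hy⟩ trivial lt).elim
    · obtain ⟨x, hx, hxy⟩ := exists_seqSucc_left lt (hu₀.trans hy.symm)
      rw [← hsucc hxy hx]
      exact ih x (hx.trans hy) hxy.1
  -- Giving `v` the tail of `u` leaves the cylinder unchanged and puts both sequences in the same
  -- tail class.
  have hv : seqCylinder v n = seqCylinder (splice n v u) n :=
    seqCylinder_congr fun i hi => (splice_of_lt _ _ hi).symm
  rw [hv, key u (SameTail.refl n u)]
  refine (key _ ?_).symm
  have := sameTail_splice (u := v) (v := u) u h.symm
  rwa [splice_eq_self (u := u) (s := u) fun _ _ => rfl] at this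

theorem Central.measurePreserving (hd : 1 ≤ d) (hT : ∀ u v, SeqSucc u v → T u = v)
    {μ : Measure (ℕ → Label a)} [IsFiniteMeasure μ] [NullSingletonClass μ] (hμ : Central μ) :
    MeasurePreserving T μ μ := by
  have hTm := measurable_of_seqSucc hd hT
  refine ⟨hTm, ?_⟩
  have hM : μ {u : ℕ → Label a | ¬ ∃ v, SeqSucc u v} = 0 :=
    (countable_not_seqSucc hd a).measure_zero μ
  have hcyl : ∀ ⦃n : ℕ⦄ ⦃u v : ℕ → Label a⦄, SeqSucc u v → SameTail n u v →
      μ.map T (seqCylinder v n) = μ (seqCylinder v n) := by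
    intro n u v h ht
    rw [Measure.map_apply hTm (measurableSet_seqCylinder v n), ← hμ ht.2]
    refine measure_congr ?_
    filter_upwards [compl_mem_ae_iff.mpr hM] with w hw
    exact propext (mem_seqCylinder_iff_of_seqSucc hT h ht (not_not.mp hw))
  -- A longer cylinder inside that of `v` is again the cylinder of a successor, by splicing, so
  -- `hcyl` applies to it as well.
  have hrestrict : ∀ ⦃n : ℕ⦄ ⦃u v : ℕ → Label a⦄, SeqSucc u v → SameTail n u v →
      (μ.map T).restrict (seqCylinder v n) = μ.restrict (seqCylinder v n) := by
    intro n u v h ht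
    refine measure_ext_of_seqCylinder fun s m => ?_
    rw [Measure.restrict_apply (measurableSet_seqCylinder s m),
      Measure.restrict_apply (measurableSet_seqCylinder s m)]
    rcases le_total m n with hmn | hmn
    · rcases seqCylinder_inter s v hmn with e | e
      · simp [e]
      · rw [e, hcyl h ht]
    · rw [inter_comm]
      by_cases hs : ∀ i < n, s i = v i
      · have h' := h.splice ht s
        rw [splice_eq_self hs] at h'
        have ht' := sameTail_splice s ht.2
        rw [splice_eq_self hs] at ht'
        rw [← seqCylinder_congr hs, inter_eq_right.mpr (seqCylinder_anti s hmn)]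
        exact hcyl h' (ht'.mono hmn)
      · rcases seqCylinder_inter v s hmn with e | e
        · simp [e]
        · exact (hs (inter_eq_right.mp e (mem_seqCylinder_self s m))).elim
  set S := {c : Set (ℕ → Label a) | ∃ n u v, SeqSucc u v ∧ SameTail n u v ∧ c = seqCylinder v n}
  have hS : S.Countable := countable_seqCylinders.mono <| by
    rintro _ ⟨n, _, v, _, _, rfl⟩
    exact ⟨v, n, rfl⟩
  have hSm : MeasurableSet (⋃₀ S) := by
    refine .sUnion hS ?_
    rintro _ ⟨n, _, v, _, _, rfl⟩
    exact measurableSet_seqCylinder v n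
  have hU : (μ.map T).restrict (⋃₀ S) = μ.restrict (⋃₀ S) := by
    have : Countable S := hS.to_subtype
    rw [sUnion_eq_iUnion, Measure.restrict_iUnion_congr]
    rintro ⟨_, n, u, v, h, ht, rfl⟩
    exact hrestrict h ht
  have hnull : μ.map T (⋃₀ S)ᶜ = 0 := by
    rw [Measure.map_apply hTm hSm.compl]
    refine measure_mono_null (show _ ⊆ {u | ¬ ∃ v, SeqSucc u v} from fun w hw hw' => hw ?_) hM
    obtain ⟨z, hz⟩ := hw'
    obtain ⟨k, hk, -⟩ := hz.1
    rw [hT w z hz]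
    exact ⟨_, ⟨k + 1, w, z, hz, hk, rfl⟩, mem_seqCylinder_self _ _⟩
  -- Equality of total masses shows that the part not covered by `S`, null for the image measure, is
  -- null for `μ` too.
  have huniv : μ.map T univ = μ univ := by
    rw [Measure.map_apply hTm MeasurableSet.univ, preimage_univ]
  have hnull' : μ (⋃₀ S)ᶜ = 0 := by
    rw [measure_compl hSm (measure_ne_top _ _), ← huniv,
      ← Measure.restrict_apply_self μ, ← hU, Measure.restrict_apply_self,
      ← measure_compl hSm (measure_ne_top _ _), hnull]
  rw [← Measure.restrict_eq_self_of_ae_mem (s := ⋃₀ S) (μ := μ.map T) (mem_ae_iff.mpr hnull), hU,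
    Measure.restrict_eq_self_of_ae_mem (s := ⋃₀ S) (mem_ae_iff.mpr hnull')]

end adic

/-! ### The shift, and factorisation of ergodic central measures -/

def shift (s : ℕ → Label a) : ℕ → Label a := fun n => s (n + 1)

/-- The sequence with first term `l`, followed by `s`. -/
def cons (l : Label a) (s : ℕ → Label a) : ℕ → Label a
  | 0 => l
  | n + 1 => s n

theorem cons_shift (s : ℕ → Label a) : cons (s 0) (shift s) = s := by
  funext i; cases i <;> rfl

theorem measurable_shift : Measurable (shift (a := a)) :=
  measurable_pi_lambda _ fun i => measurable_pi_apply (i + 1)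

theorem partialSum_cons (l : Label a) (s : ℕ → Label a) (n : ℕ) :
    partialSum (cons l s) (n + 1) = partialSum s n + l.1 := Finset.sum_range_succ' _ _

theorem seqCylinder_cons (l : Label a) (s : ℕ → Label a) (n : ℕ) :
    seqCylinder (cons l s) (n + 1) = shift ⁻¹' seqCylinder s n ∩ {u | u 0 = l} := by
  ext u
  constructor
  · exact fun h => ⟨fun i hi => h (i + 1) (by omega), h 0 (by omega)⟩
  · rintro ⟨h, h'⟩ (_ | i) hi
    · exact h'
    · exact h i (by omega)

theorem seqCylinder_update (l : Label a) (s : ℕ → Label a) (n : ℕ) :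
    seqCylinder (Function.update s n l) (n + 1) = seqCylinder s n ∩ {u | u n = l} := by
  ext u
  constructor
  · intro h
    refine ⟨fun i hi => ?_, ?_⟩
    · rw [h i (by omega), Function.update_of_ne (by omega)]
    · rw [mem_ofPred_eq, h n (by omega), Function.update_self]
  · rintro ⟨h, h'⟩ i hi
    rcases eq_or_ne i n with rfl | hne
    · rw [Function.update_self]; exact h'
    · rw [Function.update_of_ne hne, h i (by omega)]

theorem partialSum_update (l : Label a) (s : ℕ → Label a) (n : ℕ) :
    partialSum (Function.update s n l) (n + 1) = partialSum s n + l.1 := by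
  rw [partialSum_succ, Function.update_self, partialSum_congr (v := s) fun i hi => by
    rw [Function.update_of_ne (by omega)]]

theorem measure_eq_sum_eval (μ : Measure (ℕ → Label a)) (A : Set (ℕ → Label a)) (i : ℕ) :
    μ A = ∑ l : Label a, μ (A ∩ {u | u i = l}) := by
  have h := sum_measure_preimage_singleton (μ := μ.restrict A) Finset.univ
    (f := fun u : ℕ → Label a => u i) fun l _ => measurableSet_eval_eq i l
  rw [Finset.coe_univ, preimage_univ, Measure.restrict_apply_univ] at h
  rw [← h]
  refine Finset.sum_congr rfl fun l _ => ?_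
  rw [inter_comm]
  exact Measure.restrict_apply (measurableSet_eval_eq i l)

/-- Moving a label from the end of a word to its front does not change the end vertex. -/
theorem Central.measurePreserving_shift {μ : Measure (ℕ → Label a)} [IsFiniteMeasure μ]
    (hμ : Central μ) : MeasurePreserving shift μ μ := by
  refine ⟨measurable_shift, measure_ext_of_seqCylinder fun s n => ?_⟩
  rw [Measure.map_apply measurable_shift (measurableSet_seqCylinder s n),
    measure_eq_sum_eval μ _ 0, measure_eq_sum_eval μ (seqCylinder s n) n]
  refine Finset.sum_congr rfl fun l _ => ?_
  rw [← seqCylinder_cons, ← seqCylinder_update]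
  exact hμ (by rw [partialSum_cons, partialSum_update])

/-- The shifted restriction `ν` to first label `l` is central, hence `T`-invariant, and at most `μ`.
Ergodicity makes it a multiple of `μ`, and the total mass gives the factor. -/
theorem Central.measure_seqCylinder_cons (hd : 1 ≤ d) {T : (ℕ → Label a) → ℕ → Label a}
    (hT : ∀ u v, SeqSucc u v → T u = v) {μ : Measure (ℕ → Label a)} [IsProbabilityMeasure μ]
    [NullSingletonClass μ] (hμ : Central μ) (herg : Ergodic T μ) (l : Label a)
    (s : ℕ → Label a) (n : ℕ) :
    μ (seqCylinder (cons l s) (n + 1)) = μ {u | u 0 = l} * μ (seqCylinder s n) := by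
  set ν : Measure (ℕ → Label a) := (μ.restrict {u | u 0 = l}).map shift with hν
  have hcyl : ∀ s n, ν (seqCylinder s n) = μ (seqCylinder (cons l s) (n + 1)) := by
    intro s n
    rw [hν, Measure.map_apply measurable_shift (measurableSet_seqCylinder s n),
      Measure.restrict_apply (measurable_shift (measurableSet_seqCylinder s n)),
      seqCylinder_cons]
  have hle : ν ≤ μ := by
    conv_rhs => rw [← hμ.measurePreserving_shift.map_eq]
    exact Measure.map_mono Measure.restrict_le_self measurable_shift
  have hac : ν ≪ μ := Measure.absolutelyContinuous_of_le hle
  have : NullSingletonClass ν := ⟨fun x => hac (measure_singleton x)⟩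
  have hνc : Central ν := by
    intro n u v h
    rw [hcyl, hcyl]
    exact hμ (by rw [partialSum_cons, partialSum_cons, h])
  obtain ⟨c, hc⟩ := herg.eq_smul_of_absolutelyContinuous (hνc.measurePreserving hd hT) hac
  have hc' : c = μ {u | u 0 = l} := by
    have h := congrArg (fun m : Measure (ℕ → Label a) => m univ) hc
    simp only [hν, Measure.map_apply measurable_shift MeasurableSet.univ, preimage_univ,
      Measure.restrict_apply_univ, Measure.smul_apply, measure_univ, smul_eq_mul, mul_one] at h
    exact h.symm
  rw [← hcyl, hc, hc', Measure.smul_apply, smul_eq_mul]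

theorem Central.measure_seqCylinder_eq_prod (hd : 1 ≤ d) {T : (ℕ → Label a) → ℕ → Label a}
    (hT : ∀ u v, SeqSucc u v → T u = v) {μ : Measure (ℕ → Label a)} [IsProbabilityMeasure μ]
    [NullSingletonClass μ] (hμ : Central μ) (herg : Ergodic T μ) (s : ℕ → Label a) (n : ℕ) :
    μ (seqCylinder s n) = ∏ i ∈ Finset.range n, μ {u | u 0 = s i} := by
  induction n generalizing s with
  | zero => rw [seqCylinder_zero, measure_univ, Finset.prod_range_zero]
  | succ n ih =>
    have h := hμ.measure_seqCylinder_cons hd hT herg (s 0) (shift s) n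
    rw [cons_shift] at h
    rw [h, ih, Finset.prod_range_succ', mul_comm]
    rfl

theorem nontrivial_label (hd : 1 ≤ d) (a : Fin (d + 1) → ℕ+) : Nontrivial (Label a) :=
  ⟨⟨⟨0, ⟨0, (a 0).pos⟩⟩, ⟨Fin.last d, ⟨0, (a _).pos⟩⟩, fun h => by
    have h' := congrArg (fun l : Label a => (l.1 : ℕ)) h
    simp at h'
    omega⟩⟩

/-- An ergodic measure with an atom is carried by a finite set. -/
theorem nullSingletonClass_of_ergodic (hd : 1 ≤ d) {T : (ℕ → Label a) → ℕ → Label a}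
    {μ : Measure (ℕ → Label a)} [IsProbabilityMeasure μ] (herg : Ergodic T μ)
    (hpos : ∀ s n, 0 < μ (seqCylinder s n)) : NullSingletonClass μ := by
  refine ⟨fun x => ?_⟩
  by_contra hx
  set F := {y | μ {x} ≤ μ {y}} with hF
  have hfin : F.Finite := Measure.finite_const_le_meas_of_disjoint_iUnion μ
    (pos_iff_ne_zero.mpr hx) (As := fun y => {y}) (fun y => MeasurableSet.singleton y)
    (fun y z hyz => disjoint_singleton.mpr hyz) (measure_ne_top _ _)
  -- `T` never lowers point masses, because `{y}` lies in the preimage of `{T y}`.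
  have hsub : F ⊆ T ⁻¹' F := by
    intro y hy
    refine le_trans (mem_ofPred.mp hy) ?_
    rw [← herg.measure_preimage (MeasurableSet.singleton (T y)).nullMeasurableSet]
    exact measure_mono fun z hz => by rw [mem_singleton_iff.mp hz]; rfl
  rcases herg.ae_empty_or_univ_of_ae_le_preimage hfin.measurableSet.nullMeasurableSet
    (Filter.Eventually.of_forall hsub) with h | h
  · refine hx (measure_mono_null (singleton_subset_iff.mpr ?_) (ae_eq_empty.mp h))
    exact le_refl (μ {x})
  · have : Nontrivial (Label a) := nontrivial_label hd a
    -- Some cylinder around a point `y` outside the finite set `F` misses `F`, which contradicts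
    -- full support if `F` has full measure.
    obtain ⟨y, hy⟩ := hfin.exists_notMem
    have hne : ∀ z : ℕ → Label a, ∃ i, z ∈ F → z i ≠ y i := by
      intro z
      by_cases hz : z ∈ F
      · obtain ⟨i, hi⟩ := Function.ne_iff.mp (fun e => hy (e ▸ hz) : z ≠ y)
        exact ⟨i, fun _ => hi⟩
      · exact ⟨0, fun h => absurd h hz⟩
    choose N hN using hne
    obtain ⟨n, hn⟩ := (hfin.image N).bddAbove
    refine (hpos y (n + 1)).ne' (measure_mono_null (t := Fᶜ) (fun z hz hzF => ?_) (ae_eq_univ.mp h))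
    exact hN z hzF (hz _ (Nat.lt_succ_of_le (hn (mem_image_of_mem N hzF))))

/-! ### Product measures and their ergodicity -/

theorem labelMeasure_singleton (w : Label a → ℝ) (l : Label a) :
    labelMeasure w {l} = ENNReal.ofReal (w l) := by
  classical
  simp [labelMeasure, Set.indicator_apply]

theorem isProbabilityMeasure_labelMeasure {w : Label a → ℝ} (hw : ∀ l, 0 ≤ w l)
    (hsum : ∑ l, w l = 1) : IsProbabilityMeasure (labelMeasure w) := by
  refine ⟨?_⟩
  simp [labelMeasure, ← ENNReal.ofReal_sum_of_nonneg fun l _ => hw l, hsum]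

section product

variable (P : Measure (Label a)) [IsProbabilityMeasure P]

theorem infinitePi_seqCylinder (s : ℕ → Label a) (n : ℕ) :
    Measure.infinitePi (fun _ : ℕ => P) (seqCylinder s n) = ∏ i ∈ Finset.range n, P {s i} := by
  have : seqCylinder s n = (Finset.range n : Set ℕ).pi fun i => {s i} := by
    ext u; simp [seqCylinder]
  rw [this, Measure.infinitePi_pi]
  exact fun i _ => MeasurableSet.singleton _

/-- A shift-invariant set equals all its preimages under iterates, so it is a tail event, and
Kolmogorov's zero-one law applies. -/
theorem ergodic_shift_infinitePi : Ergodic shift (Measure.infinitePi fun _ : ℕ => P) where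
  measurable := measurable_shift
  map_eq := Measure.map_infinitePi_infinitePi_of_inj (P := fun _ : ℕ => P)
    (add_left_injective 1)
  aeconst_set A hA hinv := by
    have hind : ProbabilityTheory.iIndep
        (fun n => MeasurableSpace.comap (fun u : ℕ → Label a => u n) inferInstance)
        (Measure.infinitePi fun _ : ℕ => P) :=
      ProbabilityTheory.iIndepFun_infinitePi (P := fun _ : ℕ => P) (X := fun _ l => l)
        fun _ => measurable_id
    have htail : MeasurableSet[Filter.limsup
        (fun n => MeasurableSpace.comap (fun u : ℕ → Label a => u n) inferInstance)
        Filter.atTop] A := by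
      rw [Filter.limsup_eq_iInf_iSup_of_nat', MeasurableSpace.measurableSet_iInf]
      intro n
      rw [← Function.IsFixedPt.preimage_iterate hinv n]
      refine MeasurableSet.preimage hA ?_
      have hiter : ∀ (n : ℕ) (u : ℕ → Label a) (i : ℕ), shift^[n] u i = u (i + n) := by
        intro n
        induction n with
        | zero => exact fun u i => rfl
        | succ n ih =>
          intro u i
          rw [Function.iterate_succ_apply, ih]
          rfl
      refine @measurable_pi_lambda _ _ _ (_) _ _ fun i => ?_
      simp only [hiter]
      exact Measurable.of_comap_le
        (le_iSup (fun i => MeasurableSpace.comap (fun u : ℕ → Label a => u (i + n)) inferInstance) i)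
    have h01 := ProbabilityTheory.measure_zero_or_one_of_measurableSet_limsup_atTop
      (fun n => (measurable_pi_apply n).comap_le) hind htail
    rw [Filter.eventuallyConst_set']
    refine h01.imp (fun h => ae_eq_empty.mpr h) fun h => ?_
    exact ae_eq_univ.mpr ((prob_compl_eq_zero_iff hA).mpr h)

theorem nullSingletonClass_infinitePi (hP : ∀ l, P {l} < 1) :
    NullSingletonClass (Measure.infinitePi fun _ : ℕ => P) := by
  refine ⟨fun s => ?_⟩
  obtain ⟨l, hl⟩ := Finite.exists_max fun l : Label a => P {l}
  refine le_antisymm (ge_of_tendsto' (ENNReal.tendsto_pow_atTop_nhds_zero_of_lt_one (hP l))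
    fun n => ?_) zero_le
  calc _ ≤ Measure.infinitePi (fun _ : ℕ => P) (seqCylinder s n) :=
        measure_mono (singleton_subset_iff.mpr (mem_seqCylinder_self s n))
    _ = ∏ i ∈ Finset.range n, P {s i} := infinitePi_seqCylinder P s n
    _ ≤ ∏ i ∈ Finset.range n, P {l} := Finset.prod_le_prod' fun i _ => hl (s i)
    _ = P {l} ^ n := by simp

/-- For invariant `A`, the restriction of the measure to `A` is `T`-invariant, hence central, hence
shift-invariant, hence a multiple `c` of the whole measure. Evaluation at the complement of `A`
gives `c = 0` or a null complement. -/
theorem ergodic_infinitePi_of_central (hd : 1 ≤ d) {T : (ℕ → Label a) → ℕ → Label a}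
    (hT : ∀ u v, SeqSucc u v → T u = v) (hP : ∀ l, P {l} < 1)
    (hμ : Central (Measure.infinitePi fun _ : ℕ => P)) :
    Ergodic T (Measure.infinitePi fun _ : ℕ => P) := by
  have := nullSingletonClass_infinitePi P hP
  set μ := Measure.infinitePi fun _ : ℕ => P
  have hpres : MeasurePreserving T μ μ := hμ.measurePreserving hd hT
  refine ⟨hpres, ⟨fun A hA hinv => ?_⟩⟩
  have hA' : MeasurePreserving T (μ.restrict A) (μ.restrict A) := by
    have h := hpres.restrict_preimage hA
    rwa [hinv] at h
  obtain ⟨c, hc⟩ := (ergodic_shift_infinitePi P).eq_smul_of_absolutelyContinuous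
    (central_of_measurePreserving hd hT hA').measurePreserving_shift
    Measure.absolutelyContinuous_restrict
  have h0 : c * μ Aᶜ = 0 := by
    have h := congrArg (fun m : Measure (ℕ → Label a) => m Aᶜ) hc
    simpa [Measure.restrict_apply hA.compl] using h.symm
  rw [Filter.eventuallyConst_set']
  rcases mul_eq_zero.mp h0 with rfl | h0
  · left
    rw [zero_smul, Measure.restrict_eq_zero] at hc
    exact ae_eq_empty.mpr hc
  · exact .inr (ae_eq_univ.mpr h0)

end product

/-! ### Transfer between label sequences and paths -/

instance (n : ℕ) : Finite (Edge a n) := by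
  refine Finite.of_injective (β := Fin (d * n + 1) × Label a)
    (fun e => (⟨e.src, Nat.lt_succ_of_le e.src_le⟩, e.label)) ?_
  rintro ⟨k, hk, j, i⟩ ⟨k', hk', j', i'⟩ h
  simp only [Edge.label, Prod.mk.injEq, Fin.mk.injEq, Sigma.mk.injEq] at h
  obtain ⟨rfl, rfl, h⟩ := h
  obtain rfl := eq_of_heq h
  rfl

theorem ofLabels_label (γ : PathSpace a) : ofLabels (fun n => (γ.1 n).label) = γ := by
  have hsrc : ∀ n, ∑ i ∈ Finset.range n, (((γ.1 i).label.1 : Fin (d + 1)) : ℕ) = (γ.1 n).src := by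
    intro n
    induction n with
    | zero =>
      have := (γ.1 0).src_le
      rw [Finset.sum_range_zero]
      omega
    | succ n ih => rw [Finset.sum_range_succ, ih, γ.2 n]; rfl
  refine Subtype.ext (funext fun n => ?_)
  exact Edge.ext (hsrc n) rfl HEq.rfl

theorem measurable_ofLabels : Measurable (ofLabels (a := a)) := by
  refine Measurable.subtype_mk (measurable_pi_lambda _ fun n => measurable_to_countable' fun e => ?_)
  have : (fun s : ℕ → Label a => (ofLabels s).1 n) ⁻¹' {e} =
      (fun s => partialSum s n) ⁻¹' {e.src} ∩ {s | s n = e.label} := by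
    ext s
    constructor
    · rintro rfl
      exact ⟨rfl, rfl⟩
    · rintro ⟨h, h'⟩
      have h'' : s n = ⟨e.slope, e.idx⟩ := h'
      refine Edge.ext h ?_ ?_
      · change (s n).1 = _
        rw [h'']
      · change HEq (s n).2 _
        rw [h'']
  change MeasurableSet ((fun s : ℕ → Label a => (ofLabels s).1 n) ⁻¹' {e})
  rw [this]
  refine MeasurableSet.inter ?_ (measurableSet_eval_eq n _)
  refine MeasurableSet.preimage (MeasurableSet.singleton _) ?_
  exact Finset.measurable_sum _ fun i _ =>
    (Measurable.of_discrete (f := fun l : Label a => (l.1 : ℕ))).comp (measurable_pi_apply i)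

/-- Paths are determined by the labels of their edges. -/
def pathEquiv (a : Fin (d + 1) → ℕ+) : (ℕ → Label a) ≃ᵐ PathSpace a where
  toFun := ofLabels
  invFun γ n := (γ.1 n).label
  left_inv _ := rfl
  right_inv := ofLabels_label
  measurable_toFun := measurable_ofLabels
  measurable_invFun := measurable_pi_lambda _ fun n =>
    (Measurable.of_discrete (f := Edge.label)).comp ((measurable_pi_apply n).comp measurable_subtype_coe)

theorem ofLabels_edge_eq_iff {u v : ℕ → Label a} {n : ℕ} :
    (ofLabels u).1 n = (ofLabels v).1 n ↔ partialSum u n = partialSum v n ∧ u n = v n := by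
  constructor
  · exact fun h => ⟨congrArg Edge.src h, congrArg Edge.label h⟩
  · rintro ⟨h, h'⟩
    refine Edge.ext h ?_ ?_
    · change (u n).1 = (v n).1
      rw [h']
    · change HEq (u n).2 (v n).2
      rw [h']

/-- For edges with a common range, a source further left means a larger slope. -/
theorem pathLT_ofLabels_iff {u v : ℕ → Label a} :
    pathLT (ofLabels u) (ofLabels v) ↔ seqLT u v := by
  refine exists_congr fun n => ?_
  have htgt : ∀ s : ℕ → Label a, ((ofLabels s).1 n).tgt = partialSum s (n + 1) := fun s =>
    (partialSum_succ s n).symm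
  constructor
  · rintro ⟨h, ht, hlt⟩
    rw [htgt, htgt] at ht
    refine ⟨⟨fun i hi => (ofLabels_edge_eq_iff.mp (h i hi)).2, ht⟩, ?_⟩
    rw [partialSum_succ, partialSum_succ] at ht
    change partialSum u n < partialSum v n ∨
      partialSum u n = partialSum v n ∧ ((u n).2 : ℕ) < (v n).2 at hlt
    unfold labelLT
    omega
  · rintro ⟨ht, hlt⟩
    refine ⟨fun m hm => ofLabels_edge_eq_iff.mpr ⟨(ht.mono hm).2, ht.1 m hm⟩, ?_, ?_⟩
    · rw [htgt, htgt, ht.2]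
    · have ht' := ht.2
      rw [partialSum_succ, partialSum_succ] at ht'
      change partialSum u n < partialSum v n ∨
        partialSum u n = partialSum v n ∧ ((u n).2 : ℕ) < (v n).2
      unfold labelLT at hlt
      omega

theorem isSuccessor_ofLabels_iff {u v : ℕ → Label a} :
    IsSuccessor (ofLabels u) (ofLabels v) ↔ SeqSucc u v := by
  unfold IsSuccessor SeqSucc
  rw [pathLT_ofLabels_iff, (pathEquiv a).surjective.forall]
  refine and_congr_right fun _ => forall_congr' fun w => ?_
  change (pathLT (ofLabels u) (ofLabels w) → pathEquiv a w = pathEquiv a v ∨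
    pathLT (ofLabels v) (ofLabels w)) ↔ _
  rw [pathLT_ofLabels_iff, pathLT_ofLabels_iff, (pathEquiv a).injective.eq_iff]

/-- The only property of `adic` that the argument needs; its values on the maximal paths play no
role. -/
theorem adic_ofLabels {u v : ℕ → Label a} (h : SeqSucc u v) :
    (pathEquiv a).symm (adic a (pathEquiv a u)) = v := by
  have hex : ∃ ξ, IsSuccessor (pathEquiv a u) ξ := ⟨ofLabels v, isSuccessor_ofLabels_iff.mpr h⟩
  have hadic : adic a (pathEquiv a u) = hex.choose := dif_pos hex
  rw [hadic]
  have hs := hex.choose_spec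
  rw [← (pathEquiv a).apply_symm_apply hex.choose] at hs
  exact (isSuccessor_ofLabels_iff.mp hs).right_unique h

theorem preimage_cylinder (s : ℕ → Label a) (n : ℕ) :
    pathEquiv a ⁻¹' cylinder (pathEquiv a s) n = seqCylinder s n := by
  ext u
  constructor
  · exact fun h i hi => (ofLabels_edge_eq_iff.mp (h i hi)).2
  · exact fun h i hi => ofLabels_edge_eq_iff.mpr
      ⟨partialSum_congr fun k hk => h k (by omega), h i hi⟩

theorem fullySupported_map_iff {μ : Measure (ℕ → Label a)} :
    FullySupported (μ.map (pathEquiv a)) ↔ ∀ s n, 0 < μ (seqCylinder s n) := by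
  unfold FullySupported
  rw [(pathEquiv a).surjective.forall]
  simp only [MeasurableEquiv.map_apply, preimage_cylinder]

theorem ergodic_map_iff {μ : Measure (ℕ → Label a)} :
    Ergodic (adic a) (μ.map (pathEquiv a)) ↔
      Ergodic ((pathEquiv a).symm ∘ adic a ∘ pathEquiv a) μ := by
  rw [← MeasurePreserving.ergodic_conjugate_iff ((pathEquiv a).measurable.measurePreserving μ)]
  have : pathEquiv a ∘ ((pathEquiv a).symm ∘ adic a ∘ pathEquiv a) ∘ (pathEquiv a).symm =
      adic a := by
    funext γ
    simp
  rw [this]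

/-! ### The weights and their equation -/

/-- The Bernoulli measure on label sequences. -/
noncomputable def seqBernoulli (w : Label a → ℝ) : Measure (ℕ → Label a) :=
  Measure.infinitePi fun _ : ℕ => labelMeasure w

theorem bernoulli_eq_map (w : Label a → ℝ) : bernoulli w = (seqBernoulli w).map (pathEquiv a) :=
  rfl

section weights

variable {q t : ℝ}

theorem slopeWeight_eq (hq : 0 < q) (l : Label a) :
    slopeWeight a q t l = q * (t / q) ^ (l.1 : ℕ) := by
  unfold slopeWeight
  rw [zpow_sub_one₀ hq.ne', zpow_natCast, div_pow]
  field_simp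

/-- Up to the factor `q ^ (d - 1)`, the equation says that the weights sum to 1. -/
theorem charPoly_eq (hd : 1 ≤ d) (hq : 0 < q) :
    charPoly a q t = q ^ (d - 1) * (∑ l, slopeWeight a q t l - 1) := by
  rw [mul_sub, mul_one, charPoly, Fintype.sum_sigma, Finset.mul_sum]
  congr 1
  refine Finset.sum_congr rfl fun j _ => ?_
  simp only [slopeWeight_eq hq, Finset.sum_const, Finset.card_univ, Fintype.card_fin, nsmul_eq_mul]
  have h1 : q ^ (d - 1) * q = q ^ (d - (j : ℕ)) * q ^ (j : ℕ) := by
    rw [← pow_succ, ← pow_add]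
    congr 1
    have := j.2
    omega
  have h2 : q ^ (j : ℕ) * (t / q) ^ (j : ℕ) = t ^ (j : ℕ) := by
    rw [← mul_pow, mul_div_cancel₀ _ hq.ne']
  rw [← h2]
  linear_combination -((a j : ℕ) : ℝ) * (t / q) ^ (j : ℕ) * h1

theorem charPoly_eq_zero_iff (hd : 1 ≤ d) (hq : 0 < q) :
    charPoly a q t = 0 ↔ ∑ l, slopeWeight a q t l = 1 := by
  rw [charPoly_eq hd hq, mul_eq_zero, sub_eq_zero, or_iff_right (pow_pos hq _).ne']

theorem charPoly_strictMonoOn (hd : 1 ≤ d) (hq : 0 < q) :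
    StrictMonoOn (charPoly a q) (Ici 0) := by
  intro t ht t' _ htt'
  have ht : 0 ≤ t := ht
  unfold charPoly
  refine sub_lt_sub_right (Finset.sum_lt_sum (fun j _ => ?_)
    ⟨⟨1, by omega⟩, Finset.mem_univ _, ?_⟩) _
  · gcongr
  · have : 0 < ((a ⟨1, by omega⟩ : ℕ) : ℝ) := Nat.cast_pos.mpr (a _).pos
    simp only [pow_one]
    gcongr

theorem charPoly_zero (hd : 1 ≤ d) (q : ℝ) :
    charPoly a q 0 = q ^ (d - 1) * (((a 0 : ℕ) : ℝ) * q - 1) := by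
  have h : q ^ d = q ^ (d - 1) * q := by rw [← pow_succ]; congr 1; omega
  unfold charPoly
  rw [Fin.sum_univ_succ]
  simp only [Fin.val_zero, tsub_zero, pow_zero, mul_one, Fin.val_succ, ne_eq, Nat.add_eq_zero_iff,
    one_ne_zero, and_false, not_false_eq_true, zero_pow, mul_zero, Finset.sum_const_zero, add_zero]
  rw [h]
  ring

theorem charPoly_zero_neg_iff (hd : 1 ≤ d) (hq : 0 < q) :
    charPoly a q 0 < 0 ↔ q < 1 / ((a 0 : ℕ) : ℝ) := by
  have h := pow_pos hq (d - 1)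
  rw [charPoly_zero hd, mul_neg_iff, or_iff_left fun h' => h'.1.not_gt h, and_iff_right h, sub_neg,
    lt_div_iff₀ (Nat.cast_pos.mpr (a 0).pos), mul_comm]

/-- The slope-one term absorbs `-q ^ (d - 1)` since `a 1 ≥ 1`, and the slope-zero term leaves a
positive remainder. -/
theorem charPoly_one_pos (hd : 1 ≤ d) (hq : 0 < q) : 0 < charPoly a q 1 := by
  have h0 : 0 < ((a 0 : ℕ) : ℝ) * q ^ d :=
    mul_pos (Nat.cast_pos.mpr (a 0).pos) (pow_pos hq d)
  obtain ⟨e, rfl⟩ : ∃ e, d = e + 1 := ⟨d - 1, by omega⟩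
  have h1 : q ^ e ≤ ((a 1 : ℕ) : ℝ) * q ^ e :=
    le_mul_of_one_le_left (pow_pos hq e).le (Nat.one_le_cast.mpr (a 1).pos)
  have h2 : (0 : ℝ) ≤ ∑ j : Fin e, ((a j.succ.succ : ℕ) : ℝ) * q ^ (e + 1 - ((j : ℕ) + 1 + 1)) :=
    Finset.sum_nonneg fun j _ => by positivity
  unfold charPoly
  rw [Fin.sum_univ_succ, Fin.sum_univ_succ]
  simp only [one_pow, mul_one, Fin.val_zero, Fin.val_succ, tsub_zero,
    Nat.add_sub_cancel, Fin.succ_zero_eq_one, Fin.val_one] at *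
  linarith

theorem existsUnique_charPoly_eq_zero (hd : 1 ≤ d)
    (hq : q ∈ Ioo (0 : ℝ) (1 / ((a 0 : ℕ) : ℝ))) :
    ∃! t : ℝ, t ∈ Icc (0 : ℝ) 1 ∧ charPoly a q t = 0 := by
  have hcont : ContinuousOn (charPoly a q) (Icc 0 1) := by
    unfold charPoly
    fun_prop
  obtain ⟨t, ht, ht'⟩ := intermediate_value_Icc zero_le_one hcont
    ⟨((charPoly_zero_neg_iff hd hq.1).mpr hq.2).le, (charPoly_one_pos hd hq.1).le⟩
  refine ⟨t, ⟨ht, ht'⟩, fun t' h => ?_⟩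
  exact (charPoly_strictMonoOn hd hq.1).injOn (mem_Ici.mpr h.1.1) (mem_Ici.mpr ht.1)
    (h.2.trans ht'.symm)

theorem pos_of_charPoly_eq_zero (hd : 1 ≤ d) (hq : q ∈ Ioo (0 : ℝ) (1 / ((a 0 : ℕ) : ℝ)))
    (ht : t ∈ Icc (0 : ℝ) 1) (h : charPoly a q t = 0) : 0 < t := by
  rcases ht.1.eq_or_lt with rfl | h'
  · exact absurd h ((charPoly_zero_neg_iff hd hq.1).mpr hq.2).ne
  · exact h'

theorem slopeWeight_pos (hq : 0 < q) (ht : 0 < t) (l : Label a) : 0 < slopeWeight a q t l := by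
  rw [slopeWeight_eq hq]
  positivity

theorem seqBernoulli_seqCylinder {w : Label a → ℝ} (hw : ∀ l, 0 ≤ w l) (hsum : ∑ l, w l = 1)
    (s : ℕ → Label a) (n : ℕ) :
    seqBernoulli w (seqCylinder s n) = ENNReal.ofReal (∏ i ∈ Finset.range n, w (s i)) := by
  have := isProbabilityMeasure_labelMeasure hw hsum
  rw [seqBernoulli, infinitePi_seqCylinder, ENNReal.ofReal_prod_of_nonneg fun i _ => hw (s i)]
  exact Finset.prod_congr rfl fun i _ => labelMeasure_singleton w (s i)

theorem prod_slopeWeight (hq : 0 < q) (s : ℕ → Label a) (n : ℕ) :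
    ∏ i ∈ Finset.range n, slopeWeight a q t (s i) = q ^ n * (t / q) ^ partialSum s n := by
  simp only [slopeWeight_eq hq, Finset.prod_mul_distrib, Finset.prod_const, Finset.card_range,
    Finset.prod_pow_eq_pow_sum]
  rfl

theorem bernoulli_mem (hd : 1 ≤ d) (hq : 0 < q) (ht : 0 < t)
    (hsum : ∑ l, slopeWeight a q t l = 1) :
    IsProbabilityMeasure (bernoulli (slopeWeight a q t)) ∧
      Ergodic (adic a) (bernoulli (slopeWeight a q t)) ∧
      FullySupported (bernoulli (slopeWeight a q t)) := by
  have hpos := slopeWeight_pos (a := a) hq ht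
  have hcyl := seqBernoulli_seqCylinder (fun l => (hpos l).le) hsum
  have hP := isProbabilityMeasure_labelMeasure (fun l => (hpos l).le) hsum
  have hprob : IsProbabilityMeasure (seqBernoulli (slopeWeight a q t)) := by
    unfold seqBernoulli; infer_instance
  rw [bernoulli_eq_map, fullySupported_map_iff, ergodic_map_iff]
  refine ⟨Measure.isProbabilityMeasure_map (pathEquiv a).measurable.aemeasurable, ?_, ?_⟩
  · refine ergodic_infinitePi_of_central _ hd (fun u v => adic_ofLabels) (fun l => ?_) ?_
    · rw [labelMeasure_singleton, ENNReal.ofReal_lt_one, ← hsum]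
      have := nontrivial_label hd a
      obtain ⟨m, hm⟩ := exists_ne l
      exact Finset.single_lt_sum hm (Finset.mem_univ l) (Finset.mem_univ m) (hpos m)
        fun k _ _ => (hpos k).le
    · intro n u v h
      change seqBernoulli _ _ = seqBernoulli _ _
      rw [hcyl, hcyl, prod_slopeWeight hq, prod_slopeWeight hq, h]
  · intro s n
    rw [hcyl, ENNReal.ofReal_pos]
    exact Finset.prod_pos fun i _ => hpos (s i)

/-- The cylinder of a single edge of slope 0 has mass `q`. -/
theorem bernoulli_injective {q' t' : ℝ} (hq : 0 < q) (ht : 0 < t)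
    (hsum : ∑ l, slopeWeight a q t l = 1) (hq' : 0 < q') (ht' : 0 < t')
    (hsum' : ∑ l, slopeWeight a q' t' l = 1)
    (h : bernoulli (slopeWeight a q t) = bernoulli (slopeWeight a q' t')) : q = q' := by
  rw [bernoulli_eq_map, bernoulli_eq_map] at h
  have h' := congrArg (fun m => m (cylinder (pathEquiv a default) 1)) h
  simp only [MeasurableEquiv.map_apply, preimage_cylinder] at h'
  rw [seqBernoulli_seqCylinder (fun l => (slopeWeight_pos hq ht l).le) hsum,
    seqBernoulli_seqCylinder (fun l => (slopeWeight_pos hq' ht' l).le) hsum',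
    prod_slopeWeight hq, prod_slopeWeight hq', partialSum_succ] at h'
  have h0 : ((default : Label a).1 : ℕ) = 0 := rfl
  simp only [partialSum, Finset.sum_range_zero, Pi.default_apply, h0, add_zero, pow_zero, mul_one,
    pow_one] at h'
  exact (ENNReal.ofReal_eq_ofReal_iff hq.le hq'.le).mp h'

/-- Every fully supported ergodic measure is Bernoulli with weights in geometric progression. -/
theorem exists_eq_bernoulli (hd : 1 ≤ d) {μ : Measure (PathSpace a)} [IsProbabilityMeasure μ]
    (herg : Ergodic (adic a) μ) (hfull : FullySupported μ) :
    ∃ q t : ℝ, 0 < q ∧ 0 < t ∧ t ≤ 1 ∧ ∑ l, slopeWeight a q t l = 1 ∧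
      μ = bernoulli (slopeWeight a q t) := by
  obtain ⟨ν, rfl⟩ : ∃ ν : Measure (ℕ → Label a), μ = ν.map (pathEquiv a) :=
    ⟨μ.map (pathEquiv a).symm, by rw [MeasurableEquiv.map_map_symm]⟩
  have hprob : IsProbabilityMeasure ν :=
    (Measure.isProbabilityMeasure_map_iff (pathEquiv a).measurable.aemeasurable).mp inferInstance
  rw [ergodic_map_iff] at herg
  rw [fullySupported_map_iff] at hfull
  have hT : ∀ u v : ℕ → Label a, SeqSucc u v →
      ((pathEquiv a).symm ∘ adic a ∘ pathEquiv a) u = v := fun u v => adic_ofLabels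
  have := nullSingletonClass_of_ergodic hd herg hfull
  have hc : Central ν := central_of_measurePreserving hd hT herg.toMeasurePreserving
  set c : Label a → ℝ := fun l => (ν {u | u 0 = l}).toReal with hcdef
  have hν : ∀ s n, ν (seqCylinder s n) = ENNReal.ofReal (∏ i ∈ Finset.range n, c (s i)) := by
    intro s n
    rw [hc.measure_seqCylinder_eq_prod hd hT herg, ENNReal.ofReal_prod_of_nonneg fun i _ =>
      ENNReal.toReal_nonneg]
    exact Finset.prod_congr rfl fun i _ => (ENNReal.ofReal_toReal (measure_ne_top _ _)).symm
  have hc0 : ∀ l, 0 ≤ c l := fun l => ENNReal.toReal_nonneg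
  have hcpos : ∀ l, 0 < c l := by
    intro l
    have h := hfull (fun _ => l) 1
    rw [hν, ENNReal.ofReal_pos] at h
    simpa using h
  have hprod : ∀ n (u v : ℕ → Label a), partialSum u n = partialSum v n →
      ∏ i ∈ Finset.range n, c (u i) = ∏ i ∈ Finset.range n, c (v i) := by
    intro n u v h
    have h' := hc h
    rw [hν, hν] at h'
    exact (ENNReal.ofReal_eq_ofReal_iff (Finset.prod_nonneg fun i _ => hc0 _)
      (Finset.prod_nonneg fun i _ => hc0 _)).mp h'
  have hcsum : ∑ l, c l = 1 := by
    have h := measure_eq_sum_eval ν univ 0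
    rw [measure_univ] at h
    simp only [univ_inter] at h
    rw [hcdef, ← ENNReal.toReal_sum fun l _ => measure_ne_top _ _, ← h, ENNReal.toReal_one]
  let l₀ : Label a := default
  let l₁ : Label a := ⟨⟨1, by omega⟩, ⟨0, (a _).pos⟩⟩
  have hl₀ : (l₀.1 : ℕ) = 0 := rfl
  have hl₁ : (l₁.1 : ℕ) = 1 := rfl
  have hw : c = slopeWeight a (c l₀) (c l₁) := by
    have key : ∀ j : ℕ, ∀ l : Label a, (l.1 : ℕ) = j → c l = c l₀ * (c l₁ / c l₀) ^ j := by
      intro j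
      induction j with
      | zero =>
        intro l hl
        have h := hprod 1 (fun _ => l) (fun _ => l₀) (by simp [partialSum, hl, hl₀])
        simpa using h
      | succ j ih =>
        intro l hl
        have hj : j < d + 1 := by have := l.1.2; omega
        -- Both words of length two have total slope `j + 1`, once as `0 + (j + 1)` and once as `1 +
        -- j`.
        have h := hprod 2 (cons l₀ fun _ => l) (cons l₁ fun _ => ⟨⟨j, hj⟩, ⟨0, (a _).pos⟩⟩) (by
          rw [partialSum_cons, partialSum_cons]
          simp [partialSum, hl, hl₀, hl₁])
        simp only [Finset.prod_range_succ, Finset.prod_range_zero, one_mul, cons] at h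
        rw [ih ⟨⟨j, hj⟩, ⟨0, (a _).pos⟩⟩ rfl] at h
        have h0 := (hcpos l₀).ne'
        rw [pow_succ]
        field_simp
        field_simp at h
        linarith
    funext l
    rw [slopeWeight_eq (hcpos l₀)]
    exact key _ l rfl
  refine ⟨c l₀, c l₁, hcpos l₀, hcpos l₁, ?_, by rw [← hw, hcsum], ?_⟩
  · rw [← hcsum]
    exact Finset.single_le_sum (fun l _ => hc0 l) (Finset.mem_univ l₁)
  · rw [← hw, bernoulli_eq_map]
    congr 1
    exact measure_ext_of_seqCylinder fun s n => by rw [hν, seqBernoulli_seqCylinder hc0 hcsum]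

end weights

end PolyAdic

theorem mainTheorem3 (d : ℕ) (hd : 1 ≤ d) (a : Fin (d + 1) → ℕ+) :
    (∀ q ∈ Set.Ioo (0 : ℝ) (1 / ((a 0 : ℕ) : ℝ)),
      ∃! t : ℝ, t ∈ Set.Icc (0 : ℝ) 1 ∧ PolyAdic.charPoly a q t = 0) ∧
    ∀ t : ℝ → ℝ,
      (∀ q ∈ Set.Ioo (0 : ℝ) (1 / ((a 0 : ℕ) : ℝ)),
        t q ∈ Set.Icc (0 : ℝ) 1 ∧ PolyAdic.charPoly a q (t q) = 0) →
      Set.BijOn (fun q => PolyAdic.bernoulli (PolyAdic.slopeWeight a q (t q)))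
        (Set.Ioo (0 : ℝ) (1 / ((a 0 : ℕ) : ℝ)))
        {μ : MeasureTheory.Measure (PolyAdic.PathSpace a) |
          MeasureTheory.IsProbabilityMeasure μ ∧ Ergodic (PolyAdic.adic a) μ ∧
            PolyAdic.FullySupported μ} := by
  refine ⟨fun q hq => PolyAdic.existsUnique_charPoly_eq_zero hd hq, fun t ht => ?_⟩
  have hpos : ∀ q ∈ Set.Ioo (0 : ℝ) (1 / ((a 0 : ℕ) : ℝ)), 0 < t q := fun q hq =>
    PolyAdic.pos_of_charPoly_eq_zero hd hq (ht q hq).1 (ht q hq).2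
  have hsum : ∀ q ∈ Set.Ioo (0 : ℝ) (1 / ((a 0 : ℕ) : ℝ)),
      ∑ l, PolyAdic.slopeWeight a q (t q) l = 1 := fun q hq =>
    (PolyAdic.charPoly_eq_zero_iff hd hq.1).mp (ht q hq).2
  refine ⟨fun q hq => PolyAdic.bernoulli_mem hd hq.1 (hpos q hq) (hsum q hq), ?_, ?_⟩
  · intro q hq q' hq' h
    exact PolyAdic.bernoulli_injective hq.1 (hpos q hq) (hsum q hq) hq'.1 (hpos q' hq')
      (hsum q' hq') h
  · rintro μ ⟨hprob, herg, hfull⟩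
    obtain ⟨q, s, hq, hs, hs1, hqs, rfl⟩ := PolyAdic.exists_eq_bernoulli hd herg hfull
    have hchar := (PolyAdic.charPoly_eq_zero_iff hd hq).mpr hqs
    -- `charPoly a q` is strictly increasing and vanishes at `s > 0`, so it is negative at 0, which
    -- means `q < 1 / a 0`.
    have hq' : q ∈ Set.Ioo (0 : ℝ) (1 / ((a 0 : ℕ) : ℝ)) := by
      refine ⟨hq, (PolyAdic.charPoly_zero_neg_iff hd hq).mp ?_⟩
      exact (PolyAdic.charPoly_strictMonoOn hd hq (Set.mem_Ici.mpr le_rfl)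
        (Set.mem_Ici.mpr hs.le) hs).trans_eq hchar
    have : t q = s := (PolyAdic.existsUnique_charPoly_eq_zero hd hq').unique (ht q hq')
      ⟨⟨hs.le, hs1⟩, hchar⟩
    exact ⟨q, hq', by simp only [this]⟩
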